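/- Let $N\ge 2$ be an integer. Let $T$ be the equilateral triangle in $\mathbb{R}^2$ with vertices $(0,0)$, $(1,0)$, $(1/2,\sqrt3/2)$, and let $A_1,\dots,A_6:\mathbb{R}^2\to\mathbb{R}^2$ be the rotations by $0^\circ,60^\circ,120^\circ,180^\circ,240^\circ,300^\circ$ about the centre of $T$. Let $\Lambda=\{\tfrac1N\bigl(a(1,0)+b(\tfrac12,\tfrac{\sqrt3}{2})\bigr): a,b\in\mathbb{Z}\}$ be the triangular lattice of side-length $1/N$. Let $\Gamma$ be a finite non-empty index set, and for each $i\in\Gamma$ let $k_i\in\{1,\dots,6\}$ and $j_i\in\Lambda$. Let $K$ be the attractor of the iterated function system $$\mathcal{F}=\Bigl\{x\mapsto \frac{A_{k_i}(x)}{N}+j_i\Bigr\}_{i\in\Gamma},$$ that is, the unique non-empty compact set $K\subset\mathbb{R}^2$ which is the union over $i\in\Gamma$ of its images under these maps. Then $K$ is tube-null if and only if its planar Lebesgue measure $\mathcal{L}^2(K)$ is $0$. Here a tube of width $w>0$ is the closed $w/2$-neighbourhood of a line in $\mathbb{R}^2$, and a set $K\subset\mathbb{R}^2$ is called tube-null if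 for every $\epsilon>0$ there is a countable family of tubes $\{T_i\}_{i\in\mathbb{N}}$, of widths $w(T_i)$, with $K\subset\bigcup_{i\in\mathbb{N}}T_i$ and $\sum_{i\in\mathbb{N}}w(T_i)<\epsilon$. -/

import Mathlib

open Real MeasureTheory

/-- `T` is a tube of width `w > 0` in `ℝ^d`: the closed `w/2`-neighbourhood of some line. -/
def IsTube {d : ℕ} (T : Set (EuclideanSpace ℝ (Fin d))) (w : ℝ) : Prop :=
  0 < w ∧ ∃ p v : EuclideanSpace ℝ (Fin d), v ≠ 0 ∧
    T = Metric.cthickening (w / 2) (Set.range fun t : ℝ => p + t • v)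

/-- A subset of `ℝ^d` (`d ≥ 2`) is tube-null if for every `ε > 0` it is covered by a countable
family of tubes `T i` of widths `w i` with `∑ i, (w i) ^ (d - 1) < ε`. -/
def TubeNull {d : ℕ} (K : Set (EuclideanSpace ℝ (Fin d))) : Prop :=
  ∀ ε : ℝ, 0 < ε → ∃ (T : ℕ → Set (EuclideanSpace ℝ (Fin d))) (w : ℕ → ℝ),
    (∀ i, IsTube (T i) (w i)) ∧ K ⊆ ⋃ i, T i ∧
      Summable (fun i => w i ^ (d - 1)) ∧ ∑' i, w i ^ (d - 1) < ε

/-- `K` is the attractor of the family of maps `f`: the non-empty compact set that is the union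
of its images under the maps. -/
def IsAttractor {X ι : Type*} [TopologicalSpace X] (f : ι → X → X) (K : Set X) : Prop :=
  K.Nonempty ∧ IsCompact K ∧ K = ⋃ i, f i '' K

/-- The Euclidean plane. -/
abbrev Plane : Type := EuclideanSpace ℝ (Fin 2)

/-- Rotation of the plane by the angle `θ` (anticlockwise) about the point `c`. -/
noncomputable def rotationAbout (c : Plane) (θ : ℝ) (x : Plane) : Plane :=
  c + !₂[cos θ * (x 0 - c 0) - sin θ * (x 1 - c 1), sin θ * (x 0 - c 0) + cos θ * (x 1 - c 1)]

/-- The vertices `(0,0)`, `(1,0)`, `(1/2, √3/2)` of the unit equilateral triangle. -/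
noncomputable def triangleVertex : Fin 3 → Plane :=
  ![!₂[0, 0], !₂[1, 0], !₂[1 / 2, √3 / 2]]

/-- The centre of the unit equilateral triangle. -/
noncomputable def triangleCentre : Plane :=
  (1 / 3 : ℝ) • (triangleVertex 0 + triangleVertex 1 + triangleVertex 2)

/-- The six rotations by `0°, 60°, …, 300°` about the centre of the unit equilateral triangle. -/
noncomputable def triangleRotation (k : Fin 6) : Plane → Plane :=
  rotationAbout triangleCentre ((k : ℕ) * (π / 3))

/-- The regular triangular lattice of side-length `1 / N` that contains `0` and has the directions
of the unit equilateral triangle. -/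
def triangularLattice (N : ℕ) : Set Plane :=
  {x | ∃ a b : ℤ,
    x = (1 / (N : ℝ)) • ((a : ℝ) • triangleVertex 1 + (b : ℝ) • triangleVertex 2)}

/-- The map `x ↦ A_k(x) / N + j`. -/
noncomputable def triangleMap (N : ℕ) (k : Fin 6) (j : Plane) (x : Plane) : Plane :=
  (1 / (N : ℝ)) • triangleRotation k x + j

/-! A tube-null bounded set has measure zero because a tube of width `w` meets a ball in area
`O(w)`. For the converse, pass to lattice coordinates modulo `ℤ²`: the images of `K` under the six
rotations form a closed set `S` invariant under multiplication by `N`, and `volume K = 0` makes `S`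
a proper subset of the torus (`exists_proper_invariant_torus_set`). No sequence in `S` can
equidistribute, so finitely many nonzero frequencies `m` detect this uniformly: along every orbit `N
^ i • z`, one of the sums `∑ e(N ^ i m·z)` has size at least `δ n` (`exists_large_exponential_sum`).
Such a sum depends only on the real number `y = m·z`, and orthogonality with Chebyshev shows that
few `y` make it that large (`exists_volume_large_lacunary_sum_lt`). Thus `K` lies in strips, in
finitely many directions, over a set of small length. -/

/-! ### Fourier analysis on the torus. -/

theorem integral_mFourier_eq_zero {d : Type*} [Fintype d] {m : d → ℤ} (hm : m ≠ 0) :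
    ∫ x : UnitAddTorus d, UnitAddTorus.mFourier m x = 0 := by
  classical
  obtain ⟨i, hi⟩ := Function.ne_iff.mp hm
  -- Translation by half a period in a coordinate where `m` is nonzero flips the sign of the
  -- character.
  let a : UnitAddTorus d := Pi.single i (((1 : ℝ) / 2 / (m i) : ℝ) : AddCircle (1 : ℝ))
  have ha : ∀ x, UnitAddTorus.mFourier m (x + a) = -UnitAddTorus.mFourier m x := by
    intro x
    simp only [UnitAddTorus.mFourier, ContinuousMap.coe_mk, Pi.add_apply]
    rw [← Finset.mul_prod_erase _ _ (Finset.mem_univ i),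
      ← Finset.mul_prod_erase (a := i) _ (fun j => fourier (m j) (x j)) (Finset.mem_univ i),
      ← neg_mul]
    congr 1
    · simp only [a, Pi.single_eq_same]
      exact fourier_add_half_inv_index hi one_pos _
    · refine Finset.prod_congr rfl fun j hj => ?_
      simp [a, Pi.single_eq_of_ne (Finset.ne_of_mem_erase hj)]
  have h := integral_add_right_eq_self (μ := (volume : Measure (UnitAddTorus d)))
    (fun x => UnitAddTorus.mFourier m x) a
  simp only [ha, integral_neg] at h
  exact CharZero.eq_neg_self_iff.mp h.symm

/-- The distance to `S` vanishes on `S` but has mean `I > 0`. For a trigonometric polynomial close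
to it, the nonzero frequencies must cancel the constant term on `S`, so they cannot all average to
nearly zero there. -/
theorem exists_large_exponential_sum {d : Type*} [Fintype d] {S : Set (UnitAddTorus d)}
    (hS : IsClosed S) (hne : S.Nonempty) (hS' : S ≠ Set.univ) :
    ∃ (F : Finset (d → ℤ)) (δ : ℝ), 0 ∉ F ∧ 0 < δ ∧
      ∀ (n : ℕ) (x : ℕ → UnitAddTorus d), 0 < n → (∀ i, x i ∈ S) →
        ∃ m ∈ F, δ * n ≤ ‖∑ i ∈ Finset.range n, UnitAddTorus.mFourier m (x i)‖ := by
  classical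
  have hcont : Continuous fun x : UnitAddTorus d => Metric.infDist x S :=
    Metric.continuous_infDist_pt S
  set I : ℝ := ∫ x : UnitAddTorus d, Metric.infDist x S with hI
  have hIpos : 0 < I := by
    obtain ⟨y, hy⟩ := (Set.ne_univ_iff_exists_notMem S).mp hS'
    exact hcont.integral_pos_of_hasCompactSupport_nonneg_nonzero
      (HasCompactSupport.of_compactSpace _) (fun _ => Metric.infDist_nonneg)
      (x := y) (((hS.notMem_iff_infDist_pos hne).mp hy).ne')
  let g : C(UnitAddTorus d, ℂ) := ⟨fun x => (Metric.infDist x S : ℂ), by fun_prop⟩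
  have hg : g ∈ (Submodule.span ℂ
      (Set.range (UnitAddTorus.mFourier (d := d)))).topologicalClosure := by
    rw [UnitAddTorus.span_mFourier_closure_eq_top]; trivial
  rw [← SetLike.mem_coe, Submodule.topologicalClosure_coe] at hg
  obtain ⟨p, hp, hpg⟩ := Metric.mem_closure_iff.mp hg (I / 4) (by positivity)
  obtain ⟨c, rfl⟩ := Finsupp.mem_span_range_iff_exists_finsupp.mp hp
  set p : C(UnitAddTorus d, ℂ) := c.sum fun i a => a • UnitAddTorus.mFourier i with hpdef
  have hpx : ∀ x, p x = ∑ m ∈ insert 0 c.support, c m * UnitAddTorus.mFourier m x := by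
    intro x
    have h := Finsupp.sum_of_support_subset c (Finset.subset_insert 0 _)
      (fun m a => a • UnitAddTorus.mFourier (d := d) m) fun _ _ => by ext; simp
    rw [hpdef, h]
    simp [ContinuousMap.sum_apply]
  have hpg' : ∀ x, ‖p x - g x‖ ≤ I / 4 := fun x => by
    have := (p - g).norm_coe_le_norm x
    rw [← dist_eq_norm, dist_comm] at this
    exact this.trans hpg.le
  have hint : ∀ f : C(UnitAddTorus d, ℂ), Integrable (fun x => f x) volume := fun f =>
    f.continuous.integrable_of_hasCompactSupport (HasCompactSupport.of_compactSpace _)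
  have hvol : volume.real (Set.univ : Set (UnitAddTorus d)) = 1 := by
    simp [measureReal_def, volume_pi, Measure.pi_univ]
  have hintp : ∫ x, p x = c 0 := by
    simp only [hpx]
    rw [integral_finsetSum _ fun m _ => (hint _).const_mul _, Finset.sum_eq_single 0]
    · rw [integral_const_mul]
      simp [UnitAddTorus.mFourier_zero, hvol]
    · intro m _ hm
      rw [integral_const_mul, integral_mFourier_eq_zero hm, mul_zero]
    · simp
  have hintg : ∫ x, g x = (I : ℂ) := integral_ofReal
  have hc0 : ‖c 0 - I‖ ≤ I / 4 := by
    rw [← hintp, ← hintg, ← integral_sub (hint p) (hint g)]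
    refine (norm_integral_le_of_norm_le_const (C := I / 4) (ae_of_all _ hpg')).trans ?_
    rw [hvol, mul_one]
  set A : ℝ := ∑ m ∈ c.support.erase 0, ‖c m‖ with hA
  have hA0 : 0 ≤ A := Finset.sum_nonneg fun _ _ => norm_nonneg _
  -- Three errors of at most `n * I / 4` cannot add up to `n * I`; `A + 1` avoids dividing by zero.
  refine ⟨c.support.erase 0, I / (4 * (A + 1)), by simp, by positivity, fun n x hn hx => ?_⟩
  by_contra! hcon
  have hnpos : (0 : ℝ) < n := by exact_mod_cast hn
  have h1 : ‖∑ i ∈ Finset.range n, p (x i)‖ ≤ n * (I / 4) := by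
    refine (norm_sum_le_of_le _ (f := fun i => p (x i)) (n := fun _ => I / 4) fun i _ => ?_).trans
      (by simp)
    have := hpg' (x i)
    simpa [g, Metric.infDist_zero_of_mem (hx i)] using this
  have h2 : ∑ i ∈ Finset.range n, p (x i) = n * c 0 +
      ∑ m ∈ c.support.erase 0, c m * ∑ i ∈ Finset.range n, UnitAddTorus.mFourier m (x i) := by
    simp only [hpx]
    rw [Finset.sum_comm, ← Finset.insert_erase (Finset.mem_insert_self 0 c.support),
      Finset.sum_insert (Finset.notMem_erase _ _)]
    simp [UnitAddTorus.mFourier_zero, Finset.mul_sum, Finset.erase_insert_eq_erase]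
  have h3 : ‖∑ m ∈ c.support.erase 0, c m * ∑ i ∈ Finset.range n, UnitAddTorus.mFourier m (x i)‖
      ≤ A * (I / (4 * (A + 1)) * n) := by
    rw [hA, Finset.sum_mul]
    refine norm_sum_le_of_le _ fun m hm => ?_
    rw [norm_mul]
    exact mul_le_mul_of_nonneg_left (hcon m hm).le (norm_nonneg _)
  have h4 : A * (I / (4 * (A + 1)) * n) ≤ n * (I / 4) := by
    have : A * (I / (4 * (A + 1)) * n) = n * (I / 4) * (A / (A + 1)) := by field_simp
    rw [this]
    exact mul_le_of_le_one_right (by positivity) (div_le_one_of_le₀ (by linarith) (by linarith))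
  have h5 : ‖(n : ℂ) * I‖ ≤ n * (I / 4) + n * (I / 4) + n * (I / 4) := by
    have : (n : ℂ) * I = (∑ i ∈ Finset.range n, p (x i)) -
        (∑ m ∈ c.support.erase 0, c m * ∑ i ∈ Finset.range n, UnitAddTorus.mFourier m (x i)) -
        n * (c 0 - I) := by rw [h2]; ring
    rw [this]
    have h6 : ‖(n : ℂ) * (c 0 - I)‖ ≤ n * (I / 4) := by
      rw [norm_mul, Complex.norm_natCast]
      exact mul_le_mul_of_nonneg_left hc0 hnpos.le
    exact norm_sub_le_of_le (norm_sub_le_of_le h1 (h3.trans h4)) h6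
  rw [norm_mul, Complex.norm_natCast, Complex.norm_real, Real.norm_of_nonneg hIpos.le] at h5
  nlinarith [mul_pos hnpos hIpos]

/-! ### Lacunary exponential sums on an interval. -/

theorem intervalIntegral_exp_two_pi_int (R : ℕ) {q : ℤ} (hq : q ≠ 0) :
    ∫ y in (-R : ℝ)..R, Complex.exp (2 * π * Complex.I * q * y) = 0 := by
  have hq' : (q : ℂ) ≠ 0 := by exact_mod_cast hq
  rw [integral_exp_mul_complex (by simp [hq', Real.pi_ne_zero])]
  have h : 2 * π * Complex.I * q * ((R : ℝ) : ℂ) =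
      2 * π * Complex.I * q * ((-R : ℝ) : ℂ) + (2 * R * q : ℤ) * (2 * π * Complex.I) := by
    push_cast; ring
  rw [h, Complex.exp_periodic.int_mul _ _, sub_self, zero_div]

theorem integral_normSq_lacunary_sum {N : ℕ} (hN : 2 ≤ N) (R n : ℕ) :
    ∫ y in (-R : ℝ)..R,
      ‖∑ i ∈ Finset.range n, Complex.exp (2 * π * Complex.I * N ^ i * y)‖ ^ 2 = 2 * R * n := by
  have key : ∀ y : ℝ,
      ((‖∑ i ∈ Finset.range n, Complex.exp (2 * π * Complex.I * N ^ i * y)‖ ^ 2 : ℝ) : ℂ) =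
      ∑ i ∈ Finset.range n, ∑ l ∈ Finset.range n,
        Complex.exp (2 * π * Complex.I * ((N : ℤ) ^ i - (N : ℤ) ^ l : ℤ) * y) := by
    intro y
    push_cast
    rw [← Complex.mul_conj', map_sum, Finset.sum_mul_sum]
    refine Finset.sum_congr rfl fun i _ => Finset.sum_congr rfl fun l _ => ?_
    rw [← Complex.exp_conj, ← Complex.exp_add]
    congr 1
    simp [show (starRingEnd ℂ) 2 = 2 from Complex.conj_ofNat 2]
    ring
  have hcont : ∀ q : ℤ, Continuous fun y : ℝ => Complex.exp (2 * π * Complex.I * q * y) :=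
    fun q => by fun_prop
  apply Complex.ofReal_injective
  rw [← intervalIntegral.integral_ofReal]
  simp only [key]
  rw [intervalIntegral.integral_finsetSum fun i _ =>
    (continuous_finsetSum _ fun l _ => hcont _).intervalIntegrable _ _]
  have : ∀ i ∈ Finset.range n, ∫ y in (-R : ℝ)..R, ∑ l ∈ Finset.range n,
      Complex.exp (2 * π * Complex.I * ((N : ℤ) ^ i - (N : ℤ) ^ l : ℤ) * y) = 2 * R := by
    intro i hi
    rw [intervalIntegral.integral_finsetSum fun l _ => (hcont _).intervalIntegrable _ _,
      Finset.sum_eq_single i]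
    · simp; ring
    · intro l _ hl
      refine intervalIntegral_exp_two_pi_int R (sub_ne_zero.mpr fun h => hl ?_)
      exact (Nat.pow_right_injective hN (by exact_mod_cast h)).symm
    · exact fun h => absurd hi h
  rw [Finset.sum_congr rfl this]
  simp; ring

theorem exists_volume_large_lacunary_sum_lt {N : ℕ} (hN : 2 ≤ N) (R : ℕ) {δ : ℝ} (hδ : 0 < δ)
    {ε : ENNReal} (hε : 0 < ε) :
    ∃ n : ℕ, 0 < n ∧ volume {y : ℝ | y ∈ Set.Ioc (-R : ℝ) R ∧
      δ * n ≤ ‖∑ i ∈ Finset.range n, Complex.exp (2 * π * Complex.I * N ^ i * y)‖} < ε := by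
  obtain ⟨e, he, heε⟩ : ∃ e : ℝ, 0 < e ∧ ENNReal.ofReal e < ε := by
    obtain ⟨e, he, h⟩ := ENNReal.lt_iff_exists_nnreal_btwn.mp hε
    exact ⟨e, by exact_mod_cast he, by simpa using h⟩
  -- Chebyshev bounds the measure by `2 * R * n / (δ * n) ^ 2`, which this `n` makes less than `e`.
  obtain ⟨n, hn⟩ := exists_nat_gt (2 * R / (δ ^ 2 * e))
  have hn0 : (0 : ℝ) < n := lt_of_le_of_lt (by positivity) hn
  refine ⟨n, by exact_mod_cast hn0, lt_of_le_of_lt ?_ heε⟩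
  set f : ℝ → ℝ := fun y => ‖∑ i ∈ Finset.range n, Complex.exp (2 * π * Complex.I * N ^ i * y)‖ ^ 2
    with hf
  have hfc : Continuous f := by fun_prop
  have hle : (-R : ℝ) ≤ R := by linarith [(Nat.cast_nonneg R : (0 : ℝ) ≤ R)]
  have hm := mul_meas_ge_le_integral_of_nonneg (μ := volume.restrict (Set.Ioc (-R : ℝ) R))
    (ae_of_all _ fun y => (by positivity : 0 ≤ f y)) (hfc.integrableOn_Ioc) ((δ * n) ^ 2)
  rw [← intervalIntegral.integral_of_le hle, integral_normSq_lacunary_sum hN] at hm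
  have hsub : {y : ℝ | y ∈ Set.Ioc (-R : ℝ) R ∧
      δ * n ≤ ‖∑ i ∈ Finset.range n, Complex.exp (2 * π * Complex.I * N ^ i * y)‖} ⊆
      {y | (δ * n) ^ 2 ≤ f y} ∩ Set.Ioc (-R : ℝ) R := fun y hy =>
    ⟨pow_le_pow_left₀ (by positivity) hy.2 2, hy.1⟩
  refine (measure_mono hsub).trans ?_
  rw [← Measure.restrict_apply (measurableSet_le measurable_const hfc.measurable)]
  rw [ENNReal.le_ofReal_iff_toReal_le (measure_ne_top _ _) he.le]
  have h2 : (δ * n) ^ 2 * e ≥ 2 * R * n := by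
    rw [div_lt_iff₀ (by positivity)] at hn
    nlinarith
  exact le_of_mul_le_mul_left (hm.trans h2) (by positivity)

/-! ### Intervals, strips and tubes. -/

theorem exists_Ioc_cover_of_volume_lt {E : Set ℝ} {ε : ENNReal} (hE : volume E < ε) :
    ∃ a b : ℕ → ℝ, (∀ i, a i < b i) ∧ E ⊆ ⋃ i, Set.Ioc (a i) (b i) ∧
      ∑' i, ENNReal.ofReal (b i - a i) < ε := by
  have houter : StieltjesFunction.id.outer E < ε := by
    rw [Real.volume_eq_stieltjes_id, StieltjesFunction.measure_def] at hE
    exact hE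
  rw [StieltjesFunction.outer, OuterMeasure.ofFunction_apply] at houter
  obtain ⟨t, ht⟩ := iInf_lt_iff.mp houter
  obtain ⟨hEt, hsum⟩ := iInf_lt_iff.mp ht
  obtain ⟨η, hη, hηsum⟩ := ENNReal.exists_pos_sum_of_countable
    (tsub_pos_of_lt hsum).ne' ℕ
  have hbot : (botSet : Set ℝ) = ∅ := by
    ext x; simp [botSet]
  have hab : ∀ i, ∃ a b : ℝ, a < b ∧ t i ⊆ Set.Ioc a b ∧
      ENNReal.ofReal (b - a) ≤ StieltjesFunction.id.length (t i) + η i := by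
    intro i
    have hlt : StieltjesFunction.id.length (t i) < StieltjesFunction.id.length (t i) + η i :=
      ENNReal.lt_add_right ((ENNReal.le_tsum i).trans_lt (hsum.trans_le le_top)).ne
        (by exact_mod_cast (hη i).ne')
    conv_lhs at hlt => rw [StieltjesFunction.length_eq]
    simp only [iInf_lt_iff, hbot, Set.sdiff_empty] at hlt
    obtain ⟨a, b, hsub, hlt⟩ := hlt
    rcases lt_or_ge a b with h | h
    · exact ⟨a, b, h, hsub, hlt.le⟩
    -- Tubes need positive width, so an empty interval is replaced by one of length `η i`.
    · refine ⟨0, η i, by exact_mod_cast hη i, ?_, by simp⟩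
      rw [Set.Ioc_eq_empty (not_lt.mpr h)] at hsub
      exact hsub.trans (Set.empty_subset _)
  choose a b hlt hsub hle using hab
  refine ⟨a, b, hlt, hEt.trans (Set.iUnion_mono hsub), ?_⟩
  refine (ENNReal.tsum_le_tsum hle).trans_lt ?_
  rw [ENNReal.tsum_add]
  exact lt_tsub_iff_left.mp hηsum

theorem abs_dot_le_norm_mul_norm (u x : Plane) : |u 0 * x 0 + u 1 * x 1| ≤ ‖u‖ * ‖x‖ := by
  have h := abs_real_inner_le_norm u x
  simpa [PiLp.inner_apply, Fin.sum_univ_two, mul_comm] using h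

theorem norm_sq_eq_plane (u : Plane) : ‖u‖ ^ 2 = u 0 ^ 2 + u 1 ^ 2 := by
  simp [EuclideanSpace.norm_sq_eq, Fin.sum_univ_two]

theorem exists_tube_superset_strip {ξ : Plane} (hξ : ξ ≠ 0) {a b : ℝ} (hab : a < b) :
    ∃ T : Set Plane, IsTube T ((b - a) / ‖ξ‖) ∧
      ∀ x : Plane, ξ 0 * x 0 + ξ 1 * x 1 ∈ Set.Ioc a b → x ∈ T := by
  have hpos : 0 < ‖ξ‖ := norm_pos_iff.mpr hξ
  have hsq := norm_sq_eq_plane ξ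
  have hs : ξ 0 ^ 2 + ξ 1 ^ 2 ≠ 0 := by rw [← hsq]; positivity
  let v : Plane := !₂[-ξ 1, ξ 0]
  have hv : v ≠ 0 := by
    intro h
    have h0 : -ξ 1 = 0 := congrArg (fun z : Plane => z 0) h
    have h1 : ξ 0 = 0 := congrArg (fun z : Plane => z 1) h
    exact hs (by rw [h1, neg_eq_zero.mp h0]; ring)
  refine ⟨_, ⟨div_pos (sub_pos.mpr hab) hpos, ((a + b) / 2 / ‖ξ‖ ^ 2) • ξ, v, hv, rfl⟩,
    fun x hx => ?_⟩
  refine Metric.mem_cthickening_of_dist_le x _ _ _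
    ⟨(-ξ 1 * x 0 + ξ 0 * x 1) / ‖ξ‖ ^ 2, rfl⟩ ?_
  have hdiff : x - (((a + b) / 2 / ‖ξ‖ ^ 2) • ξ +
      ((-ξ 1 * x 0 + ξ 0 * x 1) / ‖ξ‖ ^ 2) • v) =
      ((ξ 0 * x 0 + ξ 1 * x 1 - (a + b) / 2) / ‖ξ‖ ^ 2) • ξ := by
    rw [hsq]
    ext i
    fin_cases i <;> simp [v] <;> field_simp <;> ring
  rw [dist_eq_norm, hdiff, norm_smul, norm_div, Real.norm_eq_abs, norm_pow, norm_norm]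
  have habs : |ξ 0 * x 0 + ξ 1 * x 1 - (a + b) / 2| ≤ (b - a) / 2 :=
    abs_le.mpr ⟨by linarith [hx.1], by linarith [hx.2]⟩
  calc |ξ 0 * x 0 + ξ 1 * x 1 - (a + b) / 2| / ‖ξ‖ ^ 2 * ‖ξ‖
      = |ξ 0 * x 0 + ξ 1 * x 1 - (a + b) / 2| / ‖ξ‖ := by field_simp
    _ ≤ (b - a) / 2 / ‖ξ‖ := by gcongr
    _ = (b - a) / ‖ξ‖ / 2 := by ring

theorem tubeNull_plane_of_countable_cover {K : Set Plane}
    (h : ∀ ε : ℝ, 0 < ε → ∃ (T : ℕ → Set Plane) (w : ℕ → ℝ),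
      (∀ i, IsTube (T i) (w i)) ∧ K ⊆ ⋃ i, T i ∧ ∑' i, ENNReal.ofReal (w i) < ENNReal.ofReal ε) :
    TubeNull K := by
  intro ε hε
  obtain ⟨T, w, hT, hK, hw⟩ := h ε hε
  have hw0 : ∀ i, 0 ≤ w i := fun i => (hT i).1.le
  have hs : Summable w := by
    have := ENNReal.summable_toReal (hw.trans_le le_top).ne
    simpa only [ENNReal.toReal_ofReal (hw0 _)] using this
  refine ⟨T, w, hT, hK, by simpa using hs, ?_⟩
  rw [← ENNReal.ofReal_tsum_of_nonneg hw0 hs] at hw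
  simpa using (ENNReal.ofReal_lt_ofReal_iff hε).mp hw

theorem volume_tube_inter_closedBall_le {T : Set Plane} {w : ℝ} (hT : IsTube T w) (R : ℝ) :
    volume (T ∩ Metric.closedBall 0 R) ≤ ENNReal.ofReal (2 * R) * ENNReal.ofReal w := by
  obtain ⟨hw, p, v, hv, rfl⟩ := hT
  have hpos : 0 < ‖v‖ := norm_pos_iff.mpr hv
  have hsq := norm_sq_eq_plane v
  let u : Plane := !₂[-v 1, v 0]
  have hu : ‖u‖ = ‖v‖ := by
    rw [← sq_eq_sq₀ (norm_nonneg _) (norm_nonneg _), norm_sq_eq_plane, norm_sq_eq_plane]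
    simp [u]; ring
  set c : ℝ := (u 0 * p 0 + u 1 * p 1) / ‖v‖ with hc
  -- A rotation taking the tube's direction to the first axis; the intersection then lies in a `2R`
  -- by `w` box.
  let M : Matrix (Fin 2) (Fin 2) ℝ := !![v 0 / ‖v‖, v 1 / ‖v‖; u 0 / ‖v‖, u 1 / ‖v‖]
  have hdet : LinearMap.det (Matrix.toLin' M) = 1 := by
    rw [LinearMap.det_toLin', Matrix.det_fin_two_of]
    simp only [u]
    simp only [Matrix.cons_val_zero, Matrix.cons_val_one]
    field_simp
    rw [hsq]; ring
  have hclosed : IsClosed (Metric.cthickening (w / 2) (Set.range fun t : ℝ => p + t • v) ∩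
      Metric.closedBall 0 R) := Metric.isClosed_cthickening.inter Metric.isClosed_closedBall
  rw [← (PiLp.volume_preserving_toLp (Fin 2)).measure_preimage
    hclosed.measurableSet.nullMeasurableSet]
  have hsub : WithLp.toLp 2 ⁻¹' (Metric.cthickening (w / 2) (Set.range fun t : ℝ => p + t • v) ∩
      Metric.closedBall 0 R) ⊆
      Matrix.toLin' M ⁻¹' Set.Icc ![-R, c - w / 2] ![R, c + w / 2] := by
    rintro y ⟨hy, hyR⟩
    have h0 : |(v 0 * y 0 + v 1 * y 1) / ‖v‖| ≤ R := by
      rw [abs_div, abs_of_pos hpos, div_le_iff₀ hpos]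
      have h1 := abs_dot_le_norm_mul_norm v (WithLp.toLp 2 y)
      have h2 : ‖(WithLp.toLp 2 y : Plane)‖ ≤ R := by simpa using hyR
      exact h1.trans ((mul_le_mul_of_nonneg_left h2 hpos.le).trans_eq (mul_comm _ _))
    have h1 : |(u 0 * y 0 + u 1 * y 1) / ‖v‖ - c| ≤ w / 2 := by
      refine le_of_forall_gt_imp_ge_of_dense fun r hr => ?_
      have hr0 : 0 < r := lt_trans (by positivity) hr
      obtain ⟨z, ⟨t, rfl⟩, hz⟩ := Set.mem_iUnion₂.mp
        (Metric.cthickening_subset_iUnion_closedBall_of_lt _ hr0 hr hy)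
      have h2 := abs_dot_le_norm_mul_norm u (WithLp.toLp 2 y - (p + t • v))
      rw [Metric.mem_closedBall, dist_eq_norm] at hz
      have h3 : (u 0 * y 0 + u 1 * y 1) / ‖v‖ - c =
          (u 0 * (WithLp.toLp 2 y - (p + t • v)) 0 +
            u 1 * (WithLp.toLp 2 y - (p + t • v)) 1) / ‖v‖ := by
        rw [hc]; simp [u]; ring
      rw [h3, abs_div, abs_of_pos hpos, div_le_iff₀ hpos]
      rw [hu] at h2
      exact h2.trans ((mul_le_mul_of_nonneg_left hz hpos.le).trans_eq (mul_comm _ _))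
    rw [abs_le] at h0 h1
    have e0 : (Matrix.toLin' M y) 0 = (v 0 * y 0 + v 1 * y 1) / ‖v‖ := by
      simp [M, Matrix.mulVec, dotProduct, Fin.sum_univ_two]; ring
    have e1 : (Matrix.toLin' M y) 1 = (u 0 * y 0 + u 1 * y 1) / ‖v‖ := by
      simp [M, Matrix.mulVec, dotProduct, Fin.sum_univ_two]; ring
    constructor <;> intro i <;> fin_cases i
    · change -R ≤ (Matrix.toLin' M y) 0; linarith
    · change c - w / 2 ≤ (Matrix.toLin' M y) 1; linarith
    · change (Matrix.toLin' M y) 0 ≤ R; linarith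
    · change (Matrix.toLin' M y) 1 ≤ c + w / 2; linarith
  refine (measure_mono hsub).trans ?_
  rw [Measure.addHaar_preimage_linearMap _ (by rw [hdet]; exact one_ne_zero), hdet,
    Real.volume_Icc_pi]
  simp only [Fin.prod_univ_two, Matrix.cons_val_zero, Matrix.cons_val_one, inv_one, abs_one,
    ENNReal.ofReal_one, one_mul]
  ring_nf
  exact le_rfl

theorem TubeNull.volume_eq_zero {K : Set Plane} (hK : Bornology.IsBounded K) (h : TubeNull K) :
    volume K = 0 := by
  obtain ⟨R, hR, hKR⟩ := hK.subset_closedBall_lt 0 0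
  refine le_antisymm (ENNReal.le_of_forall_pos_le_add fun e he _ => ?_) zero_le
  rw [zero_add]
  obtain ⟨T, w, hT, hcov, hs, hsum⟩ := h (e / (2 * R)) (by positivity)
  simp only [Nat.add_one_sub_one, pow_one] at hs hsum
  calc volume K ≤ volume (⋃ i, T i ∩ Metric.closedBall 0 R) := measure_mono fun x hx => by
        obtain ⟨i, hi⟩ := Set.mem_iUnion.mp (hcov hx)
        exact Set.mem_iUnion.mpr ⟨i, hi, hKR hx⟩
    _ ≤ ∑' i, ENNReal.ofReal (2 * R) * ENNReal.ofReal (w i) := (measure_iUnion_le _).trans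
        (ENNReal.tsum_le_tsum fun i => volume_tube_inter_closedBall_le (hT i) R)
    _ = ENNReal.ofReal (2 * R * ∑' i, w i) := by
        rw [ENNReal.tsum_mul_left, ENNReal.ofReal_mul (p := 2 * R) (by positivity),
          ENNReal.ofReal_tsum_of_nonneg (fun i => (hT i).1.le) hs]
    _ ≤ ENNReal.ofReal e := ENNReal.ofReal_le_ofReal (by
        rw [lt_div_iff₀ (by positivity)] at hsum; linarith)
    _ = e := ENNReal.ofReal_coe_nnreal

theorem tubeNull_of_forall_exists_dot_mem {K : Set Plane} {ι : Type*} [Finite ι] [Nonempty ι]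
    {ξ : ι → Plane} (hξ : ∀ i, ξ i ≠ 0)
    (h : ∀ η : ENNReal, 0 < η → ∃ E : Set ℝ, volume E < η ∧
      ∀ x ∈ K, ∃ i, ξ i 0 * x 0 + ξ i 1 * x 1 ∈ E) : TubeNull K := by
  have := Fintype.ofFinite ι
  refine tubeNull_plane_of_countable_cover fun ε hε => ?_
  have hpos : ∀ i, 0 < ‖ξ i‖ := fun i => norm_pos_iff.mpr (hξ i)
  set C : ℝ := ∑ i, 1 / ‖ξ i‖ with hC
  have hC0 : 0 < C := Finset.sum_pos (fun i _ => by have := hpos i; positivity)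
    Finset.univ_nonempty
  obtain ⟨E, hE, hKE⟩ := h (ENNReal.ofReal (ε / C)) (by simp only [ENNReal.ofReal_pos]; positivity)
  obtain ⟨a, b, hab, hcov, hsum⟩ := exists_Ioc_cover_of_volume_lt hE
  choose T hT hTx using fun (i : ι) (n : ℕ) => exists_tube_superset_strip (hξ i) (hab n)
  obtain ⟨e⟩ : Nonempty (ℕ ≃ ι × ℕ) :=
    (nonempty_equiv_of_countable (α := ι × ℕ) (β := ℕ)).map Equiv.symm
  refine ⟨fun q => T (e q).1 (e q).2, fun q => (b (e q).2 - a (e q).2) / ‖ξ (e q).1‖,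
    fun q => hT _ _, fun x hx => ?_, ?_⟩
  · obtain ⟨i, hi⟩ := hKE x hx
    obtain ⟨n, hn⟩ := Set.mem_iUnion.mp (hcov hi)
    refine Set.mem_iUnion.mpr ⟨e.symm (i, n), ?_⟩
    simpa using hTx i n x hn
  · rw [e.tsum_eq fun q : ι × ℕ => ENNReal.ofReal ((b q.2 - a q.2) / ‖ξ q.1‖), ENNReal.tsum_prod',
      tsum_fintype]
    have hterm : ∀ i, ∑' n, ENNReal.ofReal ((b n - a n) / ‖ξ i‖) =
        ENNReal.ofReal (1 / ‖ξ i‖) * ∑' n, ENNReal.ofReal (b n - a n) := by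
      intro i
      rw [← ENNReal.tsum_mul_left]
      refine tsum_congr fun n => ?_
      rw [← ENNReal.ofReal_mul (by positivity), one_div_mul_eq_div]
    simp only [hterm]
    rw [← Finset.sum_mul, ← ENNReal.ofReal_sum_of_nonneg fun i _ => by positivity, ← hC]
    calc _ < ENNReal.ofReal C * ENNReal.ofReal (ε / C) :=
          ENNReal.mul_lt_mul_right (by simpa using hC0) ENNReal.ofReal_ne_top hsum
      _ = ENNReal.ofReal ε := by
          rw [← ENNReal.ofReal_mul hC0.le, mul_div_cancel₀ _ hC0.ne']

/-! ### The torus model of the iterated function system. -/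

/-- The projection of the plane onto the standard torus. -/
def torusMk (w : Fin 2 → ℝ) : UnitAddTorus (Fin 2) := fun i => (w i : UnitAddCircle)

theorem continuous_torusMk : Continuous torusMk :=
  continuous_pi fun i => (AddCircle.continuous_mk' 1).comp (continuous_apply i)

theorem torusMk_eq_iff {w w' : Fin 2 → ℝ} :
    torusMk w = torusMk w' ↔ ∃ z : Fin 2 → ℤ, w = (fun i => (z i : ℝ)) + w' := by
  constructor
  · intro h
    have h' : ∀ i, ∃ z : ℤ, w i = z + w' i := by
      intro i
      have hi : ((w i - w' i : ℝ) : UnitAddCircle) = 0 := by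
        rw [AddCircle.coe_sub, sub_eq_zero]; exact congrFun h i
      obtain ⟨z, hz⟩ := (AddCircle.coe_eq_zero_iff 1).mp hi
      refine ⟨z, ?_⟩
      simp only [zsmul_eq_mul, mul_one] at hz
      linarith
    choose z hz using h'
    exact ⟨z, funext hz⟩
  · rintro ⟨z, rfl⟩
    funext i
    have : (((z i : ℝ)) : UnitAddCircle) = 0 := (AddCircle.coe_eq_zero_iff 1).mpr ⟨z i, by simp⟩
    simp [torusMk, this]

theorem mFourier_nsmul_torusMk (m : Fin 2 → ℤ) (q : ℕ) (w : Fin 2 → ℝ) :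
    UnitAddTorus.mFourier m (q • torusMk w) =
      Complex.exp (2 * π * Complex.I * q * ((m 0 * w 0 + m 1 * w 1 : ℝ) : ℂ)) := by
  have h : q • torusMk w = torusMk (q • w) := by
    funext i; simp [torusMk]
  rw [h]
  simp only [UnitAddTorus.mFourier, torusMk, ContinuousMap.coe_mk, Fin.prod_univ_two,
    fourier_coe_apply, ← Complex.exp_add]
  congr 1
  simp
  ring

/-- Three times the coordinates of a point of the plane in the basis given by the triangle. -/
noncomputable def latticeCoord : (Fin 2 → ℝ) →ₗ[ℝ] (Fin 2 → ℝ) :=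
  Matrix.toLin' !![3, -√3; 0, 2 * √3]

theorem latticeCoord_apply (x : Fin 2 → ℝ) :
    latticeCoord x = ![3 * x 0 - √3 * x 1, 2 * √3 * x 1] := by
  ext i
  fin_cases i <;> simp [latticeCoord, Matrix.mulVec, dotProduct, Fin.sum_univ_two]; ring

/-- The linear rotation by `60°` in lattice coordinates. -/
noncomputable def coordRotation : (Fin 2 → ℝ) →ₗ[ℝ] (Fin 2 → ℝ) := Matrix.toLin' !![0, -1; 1, 1]

theorem coordRotation_apply (w : Fin 2 → ℝ) : coordRotation w = ![-w 1, w 0 + w 1] := by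
  ext i
  fin_cases i <;> simp [coordRotation, Matrix.mulVec, dotProduct, Fin.sum_univ_two]

/-- The automorphism of the torus induced by `coordRotation`. -/
def torusRotation : UnitAddTorus (Fin 2) →+ UnitAddTorus (Fin 2) where
  toFun z := ![-z 1, z 0 + z 1]
  map_zero' := by ext i; fin_cases i <;> simp
  map_add' z z' := by ext i; fin_cases i <;> simp <;> abel

theorem continuous_torusRotation : Continuous torusRotation := by
  refine continuous_pi fun i => ?_
  fin_cases i
  · exact (continuous_apply 1).neg
  · exact (continuous_apply 0).add (continuous_apply 1)

theorem torusRotation_iterate_six : torusRotation^[6] = id := by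
  funext z i
  fin_cases i <;> simp [torusRotation, Function.iterate_succ]

theorem torusMk_coordRotation (w : Fin 2 → ℝ) :
    torusMk (coordRotation w) = torusRotation (torusMk w) := by
  rw [coordRotation_apply]
  funext i
  fin_cases i <;> simp [torusMk, torusRotation]

theorem torusMk_coordRotation_pow (l : ℕ) (w : Fin 2 → ℝ) :
    torusMk ((coordRotation ^ l) w) = torusRotation^[l] (torusMk w) := by
  induction l with
  | zero => simp
  | succ l ih => rw [pow_succ', Module.End.mul_apply, torusMk_coordRotation, ih,
      Function.iterate_succ_apply']

/-- The centre has basis coordinates `(1/3, 1/3)`, so rotation about it is linear up to a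
translation in `(1/3)ℤ²`. The factor 3 in `latticeCoord` makes that translation integral, here `(2,
-1)`. -/
theorem torusMk_rotationAbout_centre (x : Plane) :
    torusMk (latticeCoord (rotationAbout triangleCentre (π / 3) x)) =
      torusRotation (torusMk (latticeCoord x)) := by
  rw [← torusMk_coordRotation, torusMk_eq_iff]
  have h3 : √3 * √3 = 3 := Real.mul_self_sqrt (by norm_num)
  refine ⟨![2, -1], ?_⟩
  rw [coordRotation_apply, latticeCoord_apply, latticeCoord_apply]
  ext i
  fin_cases i <;> simp [rotationAbout, triangleCentre, triangleVertex]
  · linear_combination (5 / 12 - x 0 / 2) * h3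
  · linear_combination (x 0 - 1 / 3) * h3

theorem rotationAbout_add (c : Plane) (θ φ : ℝ) (x : Plane) :
    rotationAbout c (θ + φ) x = rotationAbout c θ (rotationAbout c φ x) := by
  ext i
  fin_cases i <;> simp [rotationAbout, cos_add, sin_add] <;> ring

theorem torusMk_rotationAbout_centre_mul (l : ℕ) (x : Plane) :
    torusMk (latticeCoord (rotationAbout triangleCentre (l * (π / 3)) x)) =
      torusRotation^[l] (torusMk (latticeCoord x)) := by
  induction l with
  | zero =>
    congr 2
    ext i
    fin_cases i <;> simp [rotationAbout]
  | succ l ih =>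
    rw [Nat.cast_succ, add_one_mul, add_comm, rotationAbout_add, torusMk_rotationAbout_centre, ih,
      Function.iterate_succ_apply']

theorem nsmul_torusMk_triangleMap {N : ℕ} (hN : N ≠ 0) (k : Fin 6) {j : Plane}
    (hj : j ∈ triangularLattice N) (x : Plane) :
    N • torusMk (latticeCoord (triangleMap N k j x)) =
      torusRotation^[k] (torusMk (latticeCoord x)) := by
  obtain ⟨a, b, rfl⟩ := hj
  have hN' : (N : ℝ) ≠ 0 := by exact_mod_cast hN
  have h3 : √3 * √3 = 3 := Real.mul_self_sqrt (by norm_num)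
  rw [← torusMk_rotationAbout_centre_mul]
  have h : ∀ w, N • torusMk w = torusMk (N • w) := by
    intro w; funext i; simp [torusMk]
  rw [h, torusMk_eq_iff]
  refine ⟨![3 * a, 3 * b], ?_⟩
  rw [latticeCoord_apply, latticeCoord_apply]
  ext i
  fin_cases i
  · simp [triangleMap, triangleRotation, triangleVertex]
    field_simp
    linear_combination -(b : ℝ) * h3
  · simp [triangleMap, triangleRotation, triangleVertex]
    field_simp
    linear_combination (b : ℝ) * h3

/-- Multiplication by `N` undoes the contraction and kills the lattice shift, leaving a rotation.
The union over all six rotations is therefore needed for invariance. -/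
theorem exists_proper_invariant_torus_set {N : ℕ} (hN : N ≠ 0) {Γ : Type*}
    {k : Γ → Fin 6} {j : Γ → Plane} (hj : ∀ i, j i ∈ triangularLattice N) {K : Set Plane}
    (hK : IsAttractor (fun i => triangleMap N (k i) (j i)) K) (hvol : volume K = 0) :
    ∃ S : Set (UnitAddTorus (Fin 2)), IsClosed S ∧ S ≠ Set.univ ∧ (∀ z ∈ S, N • z ∈ S) ∧
      ∀ x ∈ K, torusMk (latticeCoord x) ∈ S := by
  obtain ⟨-, hcomp, hunion⟩ := hK
  let g : ℕ → Plane → UnitAddTorus (Fin 2) := fun l x =>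
    torusRotation^[l] (torusMk (latticeCoord x))
  have hg : ∀ l, Continuous (g l) := fun l =>
    (continuous_torusRotation.iterate l).comp (continuous_torusMk.comp
      (latticeCoord.continuous_of_finiteDimensional.comp (PiLp.continuous_ofLp 2 _)))
  refine ⟨⋃ l ∈ Finset.range 6, g l '' K, ?_, ?_, ?_, fun x hx => ?_⟩
  · exact isClosed_biUnion_finset fun l _ => (hcomp.image (hg l)).isClosed
  · intro huniv
    -- Otherwise countably many integer translates of linear images of the null set `K` would cover
    -- the plane.
    have hcov : (Set.univ : Set (Fin 2 → ℝ)) ⊆ ⋃ (l : ℕ) (z : Fin 2 → ℤ),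
        (fun w => (fun i => (z i : ℝ)) + w) ''
          (((coordRotation ^ l) ∘ₗ latticeCoord) '' (WithLp.toLp 2 ⁻¹' K)) := by
      intro y _
      have hy : torusMk y ∈ ⋃ l ∈ Finset.range 6, g l '' K := huniv ▸ Set.mem_univ _
      obtain ⟨l, -, x, hx, hxy⟩ := Set.mem_iUnion₂.mp hy
      simp only [g, ← torusMk_coordRotation_pow] at hxy
      obtain ⟨z, hz⟩ := torusMk_eq_iff.mp hxy.symm
      exact Set.mem_iUnion₂.mpr ⟨l, z, _, ⟨x.ofLp, hx, rfl⟩, hz.symm⟩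
    have hK0 : volume (WithLp.toLp 2 ⁻¹' K : Set (Fin 2 → ℝ)) = 0 := by
      rw [(PiLp.volume_preserving_toLp (Fin 2)).measure_preimage
        hcomp.isClosed.measurableSet.nullMeasurableSet, hvol]
    have hnull : volume (Set.univ : Set (Fin 2 → ℝ)) = 0 := by
      refine measure_mono_null hcov (measure_iUnion_null fun l => measure_iUnion_null fun z => ?_)
      rw [Set.image_add_left, measure_preimage_add, Measure.addHaar_image_linearMap, hK0, mul_zero]
    exact isOpen_univ.measure_ne_zero volume Set.univ_nonempty hnull
  · intro z hz
    obtain ⟨l, -, x, hx, rfl⟩ := Set.mem_iUnion₂.mp hz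
    rw [hunion] at hx
    obtain ⟨i, y, hy, rfl⟩ := Set.mem_iUnion.mp hx
    refine Set.mem_iUnion₂.mpr ⟨(l + k i) % 6, by simp [Nat.mod_lt], y, hy, ?_⟩
    simp only [g]
    rw [← iterate_map_nsmul, nsmul_torusMk_triangleMap hN _ (hj i), ← Function.iterate_add_apply]
    exact Function.IsPeriodicPt.iterate_mod_apply (congrFun torusRotation_iterate_six _) _
  · exact Set.mem_iUnion₂.mpr ⟨0, by simp, x, hx, rfl⟩

/-! ### The equivalence. -/

theorem mainTheorem3 (N : ℕ) (hN : 2 ≤ N) {Γ : Type*} [Finite Γ]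
    (k : Γ → Fin 6) (j : Γ → Plane) (hj : ∀ i, j i ∈ triangularLattice N)
    (K : Set Plane) (hK : IsAttractor (fun i => triangleMap N (k i) (j i)) K) :
    TubeNull K ↔ volume K = 0 := by
  refine ⟨fun h => h.volume_eq_zero hK.2.1.isBounded, fun hvol => ?_⟩
  obtain ⟨S, hSc, hSne, hSN, hKS⟩ :=
    exists_proper_invariant_torus_set (by omega : N ≠ 0) hj hK hvol
  obtain ⟨x₀, hx₀⟩ := hK.1
  obtain ⟨F, δ, hF0, hδ, hF⟩ := exists_large_exponential_sum hSc ⟨_, hKS x₀ hx₀⟩ hSne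
  have : Nonempty F := by
    obtain ⟨m, hm, -⟩ := hF 1 (fun _ => torusMk (latticeCoord x₀)) one_pos fun _ => hKS x₀ hx₀
    exact ⟨⟨m, hm⟩⟩
  -- The transpose of `latticeCoord` applied to `m`; it is nonzero because `latticeCoord` is
  -- invertible.
  let ξ : F → Plane := fun m => !₂[3 * (m.1 0 : ℝ), -√3 * m.1 0 + 2 * √3 * m.1 1]
  have hξ : ∀ m, ξ m ≠ 0 := by
    intro m h
    have h0 : 3 * (m.1 0 : ℝ) = 0 := congrArg (fun z : Plane => z 0) h
    have h1 : -√3 * m.1 0 + 2 * √3 * m.1 1 = 0 := congrArg (fun z : Plane => z 1) h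
    have e0 : (m.1 0 : ℝ) = 0 := by linarith
    rw [e0] at h1
    have e1 : (m.1 1 : ℝ) = 0 := by simpa using h1
    refine hF0 ?_
    convert m.2
    funext i
    fin_cases i
    · exact (by exact_mod_cast e0.symm)
    · exact (by exact_mod_cast e1.symm)
  have hdot : ∀ (m : F) (x : Plane), (m.1 0 * latticeCoord x 0 + m.1 1 * latticeCoord x 1 : ℝ) =
      ξ m 0 * x 0 + ξ m 1 * x 1 := by
    intro m x
    rw [latticeCoord_apply]
    simp [ξ]
    ring
  obtain ⟨B, hB, hKB⟩ := hK.2.1.isBounded.subset_closedBall_lt 0 0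
  -- One integer `R` bounding `|ξ m · x|` for all `m` in `F` and `x` in `K`.
  obtain ⟨R, hR⟩ := exists_nat_gt ((∑ m : F, ‖ξ m‖) * B)
  refine tubeNull_of_forall_exists_dot_mem hξ fun η hη => ?_
  obtain ⟨n, hn, hE⟩ := exists_volume_large_lacunary_sum_lt hN R hδ hη
  refine ⟨_, hE, fun x hx => ?_⟩
  have horbit : ∀ i, N ^ i • torusMk (latticeCoord x) ∈ S := by
    intro i
    induction i with
    | zero => simpa using hKS x hx
    | succ i ih => rw [pow_succ', mul_smul]; exact hSN _ ih
  obtain ⟨m, hm, hle⟩ := hF n (fun i => N ^ i • torusMk (latticeCoord x)) hn horbit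
  refine ⟨⟨m, hm⟩, ?_, ?_⟩
  · have h1 := abs_dot_le_norm_mul_norm (ξ ⟨m, hm⟩) x
    have h2 : ‖ξ ⟨m, hm⟩‖ ≤ ∑ m : F, ‖ξ m‖ :=
      Finset.single_le_sum (f := fun m : F => ‖ξ m‖) (fun _ _ => norm_nonneg _) (Finset.mem_univ _)
    have h3 : ‖x‖ ≤ B := by simpa using hKB hx
    have h4 : ‖ξ ⟨m, hm⟩‖ * ‖x‖ ≤ (∑ m : F, ‖ξ m‖) * B := by gcongr
    have h5 := abs_lt.mp ((h1.trans h4).trans_lt hR)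
    exact ⟨h5.1, h5.2.le⟩
  · simp only [mFourier_nsmul_torusMk, hdot ⟨m, hm⟩] at hle
    simpa using hle
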